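/- **Theorem 1 (Representer theorem).** Let $\mathcal T$ be a set, $\mathcal H(K)$ a real reproducing kernel Hilbert space of functions on $\mathcal T$ with kernel $K$, and $\mathcal H(K\otimes K)$ the reproducing kernel Hilbert space on $\mathcal T\times\mathcal T$ with kernel $((s_1,t_1),(s_2,t_2))\mapsto K(s_1,s_2)K(t_1,t_2)$. For $C\in\mathcal H(K\otimes K)$ let $\mathcal C_C:\mathcal H(K)\to\mathcal H(K)$ be the operator $(\mathcal C_Cf)(s)=\langle C(s,\cdot),f\rangle_{\mathcal H(K)}$. Put $$\mathcal S(K)=\{C\in\mathcal H(K\otimes K): C(s,t)=C(t,s)\ \text{for all } s,t\},\qquad \mathcal S^+(K)=\{C\in\mathcal S(K): \langle\mathcal C_Cf,f\rangle_{\mathcal H(K)}\ge 0\ \text{for all } f\in\mathcal H(K)\}.$$ For $C\in\mathcal S(K)$ the operator $\mathcal C_C$ is self-adjoint and Hilbert--Schmidt; let $\tau_1(C),\tau_2(C),\dots$ be its eigenvalues, repeated according to multiplicity, and let $\Psi(C)=\sum_{k\ge1}\psi(|\tau_k(C)|)\in[0,\infty]$, where $\psi:[0,\infty)\to\mathbb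 R$ is non-decreasing with $\psi(0)=0$. Let $n,m$ be natural numbers, $T_{ij}\in\mathcal T$ ($1\le i\le n$, $1\le j\le m$), $N=nm$, and $(\tilde T_1,\dots,\tilde T_N)=(T_{11},\dots,T_{1m},\dots,T_{n1},\dots,T_{nm})$. Let $\lambda>0$ and let $\ell$ be a real-valued function of $C$ whose value on $\mathcal S(K)$ depends on $C$ only through the numbers $C(T_{ij},T_{ik})$, $1\le i\le n$, $1\le j,k\le m$. Let $\mathcal F$ be $\mathcal S^+(K)$ or $\mathcal S(K)$, and suppose that the problem $$\min_{C\in\mathcal F}\ \{\ell(C)+\lambda\Psi(C)\}$$ has a solution. Then it has a solution in $\mathrm{span}\{K(\cdot,\tilde T_i)\otimes K(\cdot,\tilde T_j): i,j=1,\dots,N\}$, where $(f\otimes g)(s,t)=f(s)g(t)$. Moreover, every solution in this space has the form $C(s,t)=z(s)^\top A\,z(t)$ for all $s,t\in\mathcal T$, where $A$ is a symmetric real $N\times N$ matrix and $z(\cdot)=(K(\cdot,\tilde T_1),\dots,K(\cdot,\tilde T_N))^\top$. -/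

import Mathlib

open scoped ENNReal InnerProductSpace Matrix

noncomputable section

namespace CovRKHS

variable {𝒯 : Type*} (H : Type*) [NormedAddCommGroup H] [InnerProductSpace ℝ H]
  [CompleteSpace H] [RKHS ℝ H 𝒯 ℝ]

/-- The function `K(·, t)`, as an element of the real RKHS `H = H(K)` on `𝒯`. -/
def kfun (t : 𝒯) : H := RKHS.kerFun H t (1 : ℝ)

/-- The reproducing kernel `K(s, t)` of `H = H(K)`. -/
def K (s t : 𝒯) : ℝ := kfun H t s

variable {H} in
/-- The reproducing property. -/
lemma inner_kfun (t : 𝒯) (f : H) : ⟪kfun H t, f⟫_ℝ = f t := by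
  simp [kfun]

lemma K_eq_inner (s t : 𝒯) : K H s t = ⟪kfun H s, kfun H t⟫_ℝ := by
  rw [inner_kfun]; rfl

lemma kernel_apply_one (s t : 𝒯) : RKHS.kernel H s t (1 : ℝ) = K H s t := by
  rw [← RKHS.kerFun_apply]; rfl

/-- The product kernel `(K ⊗ K)((s₁, t₁), (s₂, t₂)) = K(s₁, s₂) K(t₁, t₂)` on `𝒯 × 𝒯`
(Mathlib kernels are operator valued, so the real number acts as a multiple of the identity). -/
def tensorKernel : Matrix (𝒯 × 𝒯) (𝒯 × 𝒯) (ℝ →L[ℝ] ℝ) :=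
  Matrix.of fun p q => (K H p.1 q.1 * K H p.2 q.2) • ContinuousLinearMap.id ℝ ℝ

/-- The product kernel is positive semi-definite. -/
lemma tensorKernel_posSemidef : (tensorKernel H).PosSemidef := by
  refine ((RKHS.posSemidef_tfae (K := tensorKernel H)).out 0 2).2 (And.intro ?_ fun v => ?_)
  · ext p q
    have h1 : (star (ContinuousLinearMap.id ℝ ℝ)) = ContinuousLinearMap.id ℝ ℝ := star_one (ℝ →L[ℝ] ℝ)
    simp [tensorKernel, K_eq_inner, real_inner_comm, h1]
  · have h : v.sum (fun x w => v.sum fun x' w' => ⟪tensorKernel H x' x w, w'⟫_ℝ)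
        = ⟪v.sum fun x w => (w • kfun H x.1) ⊗ₜ[ℝ] kfun H x.2,
            v.sum fun x w => (w • kfun H x.1) ⊗ₜ[ℝ] kfun H x.2⟫_ℝ := by
      simp only [Finsupp.sum, sum_inner, inner_sum, TensorProduct.inner_tmul, inner_smul_left,
        inner_smul_right]
      refine Finset.sum_congr rfl fun x _ => Finset.sum_congr rfl fun y _ => ?_
      simp [tensorKernel, K_eq_inner, real_inner_comm]
      ring
    rw [h]
    exact inner_self_nonneg (𝕜 := ℝ) (E := TensorProduct ℝ H H)

instance : Fact (tensorKernel H).PosSemidef := ⟨tensorKernel_posSemidef H⟩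

/-- `H(K ⊗ K)`: the reproducing kernel Hilbert space on `𝒯 × 𝒯` with kernel `K ⊗ K`. -/
abbrev TensorRKHS : Type _ := RKHS.OfKernel (tensorKernel H)

lemma K_tensor (p q : 𝒯 × 𝒯) :
    K (TensorRKHS H) p q = K H p.1 q.1 * K H p.2 q.2 := by
  rw [← kernel_apply_one, RKHS.OfKernel.kernel_ofKernel]
  simp [tensorKernel]

variable {H}

/-- A function whose evaluations are dominated by the norm of `H` belongs to `H`. -/
lemma exists_of_bound (g : 𝒯 → ℝ) (M : ℝ)
    (h : ∀ c : 𝒯 →₀ ℝ, c.sum (fun x a => a * g x) ≤ M * ‖c.sum fun x a => a • kfun H x‖) :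
    ∃ f : H, ∀ x, f x = g x := by
  let Φ : (𝒯 →₀ ℝ) →ₗ[ℝ] H := Finsupp.linearCombination ℝ (kfun H)
  let G : (𝒯 →₀ ℝ) →ₗ[ℝ] ℝ := Finsupp.linearCombination ℝ g
  have hG : ∀ c, G c ≤ M * ‖Φ c‖ := fun c => by
    simpa [G, Φ, Finsupp.linearCombination_apply] using h c
  have hG' : ∀ c, |G c| ≤ M * ‖Φ c‖ := fun c => by
    refine abs_le.2 ⟨?_, hG c⟩
    have := hG (-c)
    simp only [map_neg, norm_neg] at this
    linarith
  have hker : LinearMap.ker Φ ≤ LinearMap.ker G := fun c hc => by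
    have := hG' c
    rw [LinearMap.mem_ker.1 hc, norm_zero, mul_zero] at this
    exact LinearMap.mem_ker.2 (abs_nonpos_iff.1 this)
  let L₀ : LinearMap.range Φ →ₗ[ℝ] ℝ :=
    (Submodule.liftQ _ G hker) ∘ₗ Φ.quotKerEquivRange.symm.toLinearMap
  have hL₀ : ∀ c, L₀ ⟨Φ c, LinearMap.mem_range_self Φ c⟩ = G c := fun c => by
    have : Φ.quotKerEquivRange.symm ⟨Φ c, LinearMap.mem_range_self Φ c⟩
        = (LinearMap.ker Φ).mkQ c := Φ.quotKerEquivRange_symm_apply_image c _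
    simp [L₀, this]
  let L : StrongDual ℝ (LinearMap.range Φ) := L₀.mkContinuous M fun y => by
    obtain ⟨_, c, rfl⟩ := y
    rw [hL₀]
    exact hG' c
  obtain ⟨L', hL', -⟩ := exists_extension_norm_eq _ L
  refine ⟨(InnerProductSpace.toDual ℝ H).symm L', fun x => ?_⟩
  have h1 : Φ (Finsupp.single x 1) = kfun H x := by simp [Φ]
  have h2 := hL' ⟨Φ (Finsupp.single x 1), LinearMap.mem_range_self Φ _⟩
  rw [← inner_kfun, real_inner_comm, InnerProductSpace.toDual_symm_apply, ← h1]
  refine h2.trans ((hL₀ _).trans ?_)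
  simp [G]

lemma bilin_bound (C : TensorRKHS H) (a b : 𝒯 →₀ ℝ) :
    a.sum (fun s x => b.sum fun t y => x * (y * C (s, t))) ≤
      ‖C‖ * (‖a.sum fun s x => x • kfun H s‖ * ‖b.sum fun t y => y • kfun H t‖) := by
  set w : TensorRKHS H :=
    a.sum fun s x => b.sum fun t y => (x * y) • kfun (TensorRKHS H) (s, t) with hw
  have h1 : a.sum (fun s x => b.sum fun t y => x * (y * C (s, t))) = ⟪w, C⟫_ℝ := by
    simp only [hw, Finsupp.sum, sum_inner, inner_smul_left, inner_kfun]
    simp [mul_assoc]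
  have h2 : ‖w‖ ^ 2 = (‖a.sum fun s x => x • kfun H s‖ * ‖b.sum fun t y => y • kfun H t‖) ^ 2 := by
    rw [mul_pow]
    simp only [← real_inner_self_eq_norm_sq]
    simp only [hw, Finsupp.sum, sum_inner, inner_sum, inner_smul_left, inner_smul_right,
      ← K_eq_inner, K_tensor, Finset.sum_mul, Finset.mul_sum]
    rw [Finset.sum_comm]
    refine Finset.sum_congr rfl fun i _ => ?_
    rw [Finset.sum_comm (s := b.support)]
    refine Finset.sum_congr rfl fun j _ => ?_
    rw [Finset.sum_comm]
    refine Finset.sum_congr rfl fun k _ => Finset.sum_congr rfl fun l _ => ?_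
    simp
    ring
  have h3 : ‖w‖ = ‖a.sum fun s x => x • kfun H s‖ * ‖b.sum fun t y => y • kfun H t‖ :=
    (sq_eq_sq₀ (norm_nonneg _) (by positivity)).1 h2
  rw [h1, ← h3, mul_comm]
  exact real_inner_le_norm w C

/-- For `C ∈ H(K ⊗ K)` every section `C(s, ·)` belongs to `H(K)`. -/
lemma exists_slice (C : TensorRKHS H) (s : 𝒯) : ∃ f : H, ∀ t, f t = C (s, t) := by
  refine exists_of_bound _ (‖C‖ * ‖kfun H s‖) fun c => ?_
  have := bilin_bound C (Finsupp.single s 1) c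
  simpa [mul_assoc] using this

/-- The section `C(s, ·)` as an element of `H(K)`. -/
def slice (C : TensorRKHS H) (s : 𝒯) : H := (exists_slice C s).choose

@[simp]
lemma slice_apply (C : TensorRKHS H) (s t : 𝒯) : slice C s t = C (s, t) :=
  (exists_slice C s).choose_spec t

lemma exists_covOp (C : TensorRKHS H) (f : H) :
    ∃ g : H, ∀ s, g s = ⟪slice C s, f⟫_ℝ := by
  refine exists_of_bound _ (‖C‖ * ‖f‖) fun c => ?_
  set w : H := c.sum fun s x => x • slice C s with hw
  set u : H := c.sum fun s x => x • kfun H s with hu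
  have h1 : c.sum (fun s x => x * ⟪slice C s, f⟫_ℝ) = ⟪w, f⟫_ℝ := by
    simp [hw, Finsupp.sum, sum_inner, inner_smul_left]
  have h2 : ∀ v : H, ⟪w, v⟫_ℝ ≤ ‖C‖ * ‖u‖ * ‖v‖ := fun v => by
    have hv : v ∈ (Submodule.span ℝ {RKHS.kerFun H x r | (x : 𝒯) (r : ℝ)}).topologicalClosure := by
      rw [RKHS.kerFun_dense]; trivial
    refine closure_minimal (t := {v : H | ⟪w, v⟫_ℝ ≤ ‖C‖ * ‖u‖ * ‖v‖}) (fun v hv => ?_)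
      (isClosed_le (by fun_prop) (by fun_prop)) hv
    have hle : Submodule.span ℝ {RKHS.kerFun H x r | (x : 𝒯) (r : ℝ)}
        ≤ Submodule.span ℝ (Set.range (kfun H)) := by
      refine Submodule.span_le.2 ?_
      rintro _ ⟨x, r, rfl⟩
      have : RKHS.kerFun H x r = r • kfun H x := by
        rw [kfun, ← map_smul]; simp
      rw [this]
      exact Submodule.smul_mem _ _ (Submodule.subset_span ⟨x, rfl⟩)
    obtain ⟨b, rfl⟩ := Finsupp.mem_span_range_iff_exists_finsupp.1 (hle hv)
    have h := bilin_bound C c b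
    rw [← hu, ← mul_assoc] at h
    refine le_of_eq_of_le ?_ h
    simp only [hw, Finsupp.sum, sum_inner, inner_sum, inner_smul_left, inner_smul_right]
    simp only [Finset.mul_sum]
    rw [Finset.sum_comm]
    refine Finset.sum_congr rfl fun i _ => Finset.sum_congr rfl fun j _ => ?_
    rw [real_inner_comm, inner_kfun, slice_apply]
    simp
    ring
  have h3 : ‖w‖ ≤ ‖C‖ * ‖u‖ := by
    rcases eq_or_ne ‖w‖ 0 with h0 | h0
    · rw [h0]; positivity
    · have := h2 w
      rw [real_inner_self_eq_norm_mul_norm] at this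
      exact le_of_mul_le_mul_right this (lt_of_le_of_ne (norm_nonneg _) h0.symm)
  rw [h1]
  calc ⟪w, f⟫_ℝ ≤ ‖w‖ * ‖f‖ := real_inner_le_norm _ _
    _ ≤ ‖C‖ * ‖u‖ * ‖f‖ := by gcongr
    _ = ‖C‖ * ‖f‖ * ‖u‖ := by ring

/-- The operator `𝒞_C : H(K) → H(K)` given by `(𝒞_C f)(s) = ⟨C(s, ·), f⟩`. -/
def covOp (C : TensorRKHS H) : H →ₗ[ℝ] H where
  toFun f := (exists_covOp C f).choose
  map_add' f g := by
    ext s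
    rw [RKHS.coe_add, Pi.add_apply, (exists_covOp C (f + g)).choose_spec s,
      (exists_covOp C f).choose_spec s, (exists_covOp C g).choose_spec s, inner_add_right]
  map_smul' c f := by
    ext s
    rw [RKHS.coe_smul, Pi.smul_apply, (exists_covOp C (c • f)).choose_spec s, RingHom.id_apply,
      (exists_covOp C f).choose_spec s, inner_smul_right, smul_eq_mul]

/-- The defining formula of `𝒞_C`. -/
lemma covOp_apply (C : TensorRKHS H) (f : H) (s : 𝒯) :
    covOp C f s = ⟪slice C s, f⟫_ℝ :=
  (exists_covOp C f).choose_spec s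

variable (H) in
/-- `𝒮(K)`: the symmetric elements of `H(K ⊗ K)`. -/
def symSet : Set (TensorRKHS H) := {C | ∀ s t, C (s, t) = C (t, s)}

variable (H) in
/-- `𝒮⁺(K)`: the elements `C` of `𝒮(K)` with `⟨𝒞_C f, f⟩ ≥ 0` for all `f ∈ H(K)`. -/
def posSet : Set (TensorRKHS H) := {C | C ∈ symSet H ∧ ∀ f : H, 0 ≤ ⟪covOp C f, f⟫_ℝ}

/-- The spectral penalty `Ψ(C) = ∑ₖ ψ(|τₖ(C)|) ∈ [0, ∞]`, where the `τₖ(C)` are the eigenvalues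
of `𝒞_C` repeated according to multiplicity: each real `μ` contributes `ψ(|μ|)` as often as the
dimension of its eigenspace. For `μ ≠ 0` that dimension is finite as `𝒞_C` is compact, and
`μ = 0` contributes nothing as `ψ(0) = 0`. -/
def Psi (ψ : ℝ → ℝ) (C : TensorRKHS H) : ℝ≥0∞ :=
  ∑' μ : ℝ, (Module.finrank ℝ (Module.End.eigenspace (covOp C) μ) : ℝ≥0∞) *
    ENNReal.ofReal (ψ |μ|)

/-- The objective `ℓ(C) + λ Ψ(C)`, with values in `(-∞, ∞]`. -/
def objective (l : TensorRKHS H → ℝ) (lam : ℝ) (ψ : ℝ → ℝ) (C : TensorRKHS H) : EReal :=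
  ((l C : ℝ) : EReal) + ((ENNReal.ofReal lam * Psi ψ C : ℝ≥0∞) : EReal)

/-- The set of minimizers over `F` of the objective `ℓ(C) + λ Ψ(C)`. -/
def solutionSet (F : Set (TensorRKHS H)) (l : TensorRKHS H → ℝ) (lam : ℝ) (ψ : ℝ → ℝ) :
    Set (TensorRKHS H) :=
  {C | C ∈ F ∧ ∀ C' ∈ F, objective l lam ψ C ≤ objective l lam ψ C'}

/-- The list `(T₁₁, …, T₁ₘ, T₂₁, …, T₂ₘ, …, Tₙ₁, …, Tₙₘ)` of length `N = n m`. -/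
def pooled {n m : ℕ} (T : Fin n → Fin m → 𝒯) (p : Fin (n * m)) : 𝒯 :=
  T (finProdFinEquiv.symm p).1 (finProdFinEquiv.symm p).2

/-- The tensor product of functions `(f ⊗ g)(s, t) = f(s) g(t)`. -/
def tensorFun (f g : 𝒯 → ℝ) : 𝒯 × 𝒯 → ℝ := fun p => f p.1 * g p.2

variable (H) in
/-- The space `span {K(·, uᵢ) ⊗ K(·, uⱼ)}` of functions on `𝒯 × 𝒯`. -/
def kernelSpan {N : ℕ} (u : Fin N → 𝒯) : Submodule ℝ (𝒯 × 𝒯 → ℝ) :=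
  Submodule.span ℝ (Set.range fun ij : Fin N × Fin N =>
    tensorFun (fun s => K H s (u ij.1)) (fun t => K H t (u ij.2)))

variable (H) in
/-- The vector `z(s) = (K(s, u₁), …, K(s, u_N))`. -/
def z {N : ℕ} (u : Fin N → 𝒯) (s : 𝒯) : Fin N → ℝ := fun i => K H s (u i)

end CovRKHS

end

/-!
Every minimizer can be compressed. Let `V` be the span of the sections `K(·, T̃ᵢ)` and `P` the
orthogonal projection onto it. For a minimizer `C`, the operator `P 𝒞_C P` is a combination of
rank-one operators built from the sections `K(·, T̃ᵢ)`, hence equals `𝒞_D` for some `D` in the span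
of the functions `K(·, T̃ᵢ) ⊗ K(·, T̃ⱼ)` (`exists_covOpL_eq_compression`). As
`C(s, t) = ⟨K(·, s), 𝒞_C K(·, t)⟩` and `P` fixes the sections at the sampling points, `C` and `D`
agree at all pairs of sampling points, so `ℓ(D) = ℓ(C)`; symmetry and positivity pass to the
compression. It remains to see that `Ψ(D) ≤ Ψ(C)`.

The operators `𝒞_C` are compact (`isCompactOperator_covOpL`), being norm limits of operators of
finite rank. For a compact self-adjoint operator `S` and `a > 0`, a min-max argument shows that
`P S P` has at most as many eigenvalues of modulus at least `a` as `S`, counted with multiplicity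
(`exists_finset_sum_finrank_compression_le`). Since `ψ` is non-decreasing with `ψ(0) = 0`, summing
over the levels of `ψ` turns these counting inequalities into `Ψ(D) ≤ Ψ(C)`
(`sum_mul_le_sum_mul_of_count_le`).

The matrix form of a symmetric element of the span is obtained by symmetrizing its coefficients
(`exists_isSymm_matrix_of_mem_kernelSpan`).
-/

noncomputable section

namespace CovRKHS

/-! ### Eigenvalue counts of compact self-adjoint operators -/

section Spectral

open Module Module.End

lemma finrank_biSup_of_iSupIndep {ι M : Type*} [AddCommGroup M] [Module ℝ M]
    {p : ι → Submodule ℝ M} (hp : iSupIndep p) (t : Finset ι)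
    (hfin : ∀ i ∈ t, FiniteDimensional ℝ (p i)) :
    FiniteDimensional ℝ (⨆ i ∈ t, p i : Submodule ℝ M) ∧
      finrank ℝ (⨆ i ∈ t, p i : Submodule ℝ M) = ∑ i ∈ t, finrank ℝ (p i) := by
  classical
  induction t using Finset.induction_on with
  | empty =>
    have h : (⨆ i ∈ (∅ : Finset ι), p i) = ⊥ := by simp
    rw [h, finrank_bot, Finset.sum_empty]
    exact ⟨inferInstance, rfl⟩
  | insert i t hi ih =>
    obtain ⟨h1, h2⟩ := ih fun j hj => hfin j (Finset.mem_insert_of_mem hj)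
    have h3 := hfin i (Finset.mem_insert_self i t)
    rw [Finset.iSup_insert, Finset.sum_insert hi]
    refine ⟨inferInstance, ?_⟩
    have hdisj : Disjoint (p i) (⨆ j ∈ t, p j) := by
      simpa using hp.disjoint_biSup (y := (t : Set ι)) (by simpa using hi)
    have h4 := Submodule.finrank_sup_add_finrank_inf_eq (p i) (⨆ j ∈ t, p j)
    rw [hdisj.eq_bot, finrank_bot, add_zero, h2] at h4
    exact h4

variable {E : Type*} [NormedAddCommGroup E] [InnerProductSpace ℝ E]

/-- A nonzero compact self-adjoint operator attains its norm at an eigenvalue. -/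
lemma exists_hasEigenvalue_abs_eq_norm [CompleteSpace E] {S : E →L[ℝ] E}
    (hS : IsCompactOperator S) (hsym : S.IsSymmetric) (h0 : S ≠ 0) :
    ∃ μ : ℝ, HasEigenvalue (S : E →ₗ[ℝ] E) μ ∧ |μ| = ‖S‖ := by
  have hr := S.spectralRadius_eq_nnnorm hsym.isSelfAdjoint
  have hne : (spectrum ℝ S).Nonempty := by
    by_contra h
    rw [Set.not_nonempty_iff_eq_empty] at h
    rw [spectralRadius, h] at hr
    simp at hr
    exact h0 (by simpa using hr.symm)
  obtain ⟨μ, hμ, hμ'⟩ := spectrum.exists_nnnorm_eq_spectralRadius_of_nonempty hne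
  rw [hr, ENNReal.coe_inj] at hμ'
  have habs : |μ| = ‖S‖ := by
    simpa using congrArg NNReal.toReal hμ'
  have hμ0 : μ ≠ 0 := by
    rintro rfl
    exact h0 (norm_eq_zero.1 (by simpa using habs.symm))
  exact ⟨μ, (hS.hasEigenvalue_iff_mem_spectrum hμ0).2 hμ, habs⟩

lemma le_norm_apply_of_mem_biSup_eigenspace {S : E →ₗ[ℝ] E} (hS : S.IsSymmetric) {a : ℝ}
    (ha : 0 ≤ a) (s : Finset ℝ) (hs : ∀ μ ∈ s, a ≤ |μ|) {x : E}
    (hx : x ∈ ⨆ μ ∈ s, eigenspace S μ) : a * ‖x‖ ≤ ‖S x‖ := by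
  obtain ⟨v, rfl⟩ := (Submodule.mem_iSup_finset_iff_exists_sum _ _).1 hx
  have h1 := hS.orthogonalFamily_eigenspaces.norm_sum v s
  have h2 := hS.orthogonalFamily_eigenspaces.norm_sum (fun μ => μ • v μ) s
  simp only [Submodule.coe_subtypeₗᵢ, Submodule.coe_subtype, Submodule.coe_smul] at h1 h2
  have h3 : S (∑ μ ∈ s, (v μ : E)) = ∑ μ ∈ s, μ • (v μ : E) := by
    rw [map_sum]
    exact Finset.sum_congr rfl fun μ _ => mem_eigenspace_iff.1 (v μ).2
  refine (sq_le_sq₀ (by positivity) (norm_nonneg _)).1 ?_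
  rw [h3, mul_pow, h1, h2, Finset.mul_sum]
  refine Finset.sum_le_sum fun μ hμ => ?_
  have h4 : a ^ 2 ≤ |μ| ^ 2 := pow_le_pow_left₀ ha (hs μ hμ) 2
  rw [norm_smul, mul_pow, Real.norm_eq_abs]
  exact mul_le_mul_of_nonneg_right h4 (by positivity)

/-- If `t` contains all eigenvalues of modulus at least `a`, then `S` contracts by a factor less than
`a` on the orthogonal complement of the corresponding eigenspaces: the restriction of `S` to this
complement attains its norm at an eigenvalue, which is one of the remaining eigenvalues of `S`. -/
lemma norm_apply_lt_of_mem_orthogonal [CompleteSpace E] {S : E →L[ℝ] E} (hS : IsCompactOperator S)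
    (hsym : S.IsSymmetric) {a : ℝ} (ha : 0 < a) (t : Finset ℝ)
    (ht : ∀ μ, a ≤ |μ| → μ ∉ t → eigenspace (S : E →ₗ[ℝ] E) μ = ⊥) {x : E}
    (hx : x ∈ (⨆ μ ∈ t, eigenspace (S : E →ₗ[ℝ] E) μ)ᗮ) (hx0 : x ≠ 0) :
    ‖S x‖ < a * ‖x‖ := by
  set U : Submodule ℝ E := ⨆ μ ∈ t, eigenspace (S : E →ₗ[ℝ] E) μ
  have hinv : ∀ y ∈ Uᗮ, (S : E →ₗ[ℝ] E) y ∈ Uᗮ := by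
    have hU' : ∀ u ∈ U, S u ∈ U := by
      intro u hu
      obtain ⟨v, rfl⟩ := (Submodule.mem_iSup_finset_iff_exists_sum _ _).1 hu
      rw [map_sum]
      refine Submodule.sum_mem _ fun μ hμ => ?_
      have : S (v μ : E) = μ • (v μ : E) := mem_eigenspace_iff.1 (v μ).2
      rw [this]
      exact Submodule.smul_mem _ _ (Submodule.mem_iSup_of_mem μ
        (Submodule.mem_iSup_of_mem hμ (v μ).2))
    intro y hy u hu
    have := hsym u y
    exact this.symm.trans (hy _ (hU' u hu))
  let R : Uᗮ →L[ℝ] Uᗮ := S.restrict hinv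
  have hRc : IsCompactOperator R := hS.restrict' hinv
  have hRs : R.IsSymmetric := hsym.restrict_invariant hinv
  have hRa : ‖R‖ < a := by
    rcases eq_or_ne R 0 with h0 | h0
    · rw [h0]
      exact ContinuousLinearMap.opNorm_zero.trans_lt ha
    obtain ⟨μ, hμ, hμR⟩ := exists_hasEigenvalue_abs_eq_norm hRc hRs h0
    rw [← hμR]
    by_contra! hle
    obtain ⟨y, hy, hy0⟩ := hμ.exists_hasEigenvector
    have hyS : (y : E) ∈ eigenspace (S : E →ₗ[ℝ] E) μ :=
      mem_eigenspace_iff.2 (congrArg Subtype.val (mem_eigenspace_iff.1 hy))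
    have hyU : (y : E) ∈ U := by
      by_cases hμt : μ ∈ t
      · exact Submodule.mem_iSup_of_mem μ (Submodule.mem_iSup_of_mem hμt hyS)
      · rw [ht μ hle hμt, Submodule.mem_bot] at hyS
        rw [hyS]; exact zero_mem _
    have := y.2 _ hyU
    exact hy0 (Subtype.ext (inner_self_eq_zero.1 this))
  calc ‖S x‖ = ‖R ⟨x, hx⟩‖ := rfl
    _ ≤ ‖R‖ * ‖x‖ := R.le_opNorm _
    _ < a * ‖x‖ := mul_lt_mul_of_pos_right hRa (norm_pos_iff.2 hx0)

/-- The half of the min-max principle that is needed: if `‖S x‖ ≥ a ‖x‖` on a subspace `W`, then `S`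
has at least `dim W` eigenvalues of modulus at least `a`, counted with multiplicity. -/
lemma exists_finset_finrank_le_sum [CompleteSpace E] {S : E →L[ℝ] E} (hS : IsCompactOperator S)
    (hsym : S.IsSymmetric) {a : ℝ} (ha : 0 < a) (W : Submodule ℝ E) [FiniteDimensional ℝ W]
    (hW : ∀ x ∈ W, a * ‖x‖ ≤ ‖S x‖) :
    ∃ t : Finset ℝ, (∀ μ ∈ t, a ≤ |μ|) ∧
      finrank ℝ W ≤ ∑ μ ∈ t, finrank ℝ (eigenspace (S : E →ₗ[ℝ] E) μ) := by
  classical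
  by_contra! hcon
  have hfin : ∀ μ : ℝ, a ≤ |μ| → FiniteDimensional ℝ (eigenspace (S : E →ₗ[ℝ] E) μ) :=
    fun μ hμ => ContinuousLinearMap.finite_dimensional_eigenspace hS μ
      (abs_pos.1 (ha.trans_le hμ))
  let A : Set ℕ := {k | ∃ t : Finset ℝ, (∀ μ ∈ t, a ≤ |μ|) ∧
    ∑ μ ∈ t, finrank ℝ (eigenspace (S : E →ₗ[ℝ] E) μ) = k}
  have hAne : A.Nonempty := ⟨0, ∅, by simp, by simp⟩
  have hAb : BddAbove A := ⟨finrank ℝ W, by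
    rintro _ ⟨t, ht, rfl⟩
    exact (hcon t ht).le⟩
  -- If all counts stay below `dim W`, a set `t` with the largest count exhausts the eigenvalues of
  -- modulus at least `a`.
  obtain ⟨t, ht, htA⟩ := Nat.sSup_mem hAne hAb
  have hmax : ∀ μ, a ≤ |μ| → μ ∉ t → eigenspace (S : E →ₗ[ℝ] E) μ = ⊥ := by
    intro μ hμ hμt
    have := hfin μ hμ
    have h1 := le_csSup hAb ⟨insert μ t, by simpa using ⟨hμ, ht⟩, rfl⟩
    rw [Finset.sum_insert hμt, htA] at h1
    exact Submodule.finrank_eq_zero.1 (by omega)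
  obtain ⟨hUfin, hUdim⟩ := finrank_biSup_of_iSupIndep
    (eigenspaces_iSupIndep (S : E →ₗ[ℝ] E)) t fun μ hμ => hfin μ (ht μ hμ)
  set U : Submodule ℝ E := ⨆ μ ∈ t, eigenspace (S : E →ₗ[ℝ] E) μ
  have hlt : finrank ℝ U < finrank ℝ W := hUdim ▸ hcon t ht
  -- The orthogonal projection of `W` onto `U` has a non-trivial kernel.
  let q : W →ₗ[ℝ] U := (U.orthogonalProjectionOnto : E →ₗ[ℝ] U) ∘ₗ W.subtype
  obtain ⟨x, hx, hx0⟩ := (Submodule.ne_bot_iff _).1 (LinearMap.ker_ne_bot_of_finrank_lt (f := q) hlt)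
  have hxU : (x : E) ∈ Uᗮ := by
    rw [← Submodule.orthogonalProjectionOnto_eq_zero_iff]
    exact LinearMap.mem_ker.1 hx
  exact absurd (hW x x.2) (not_le.2 (norm_apply_lt_of_mem_orthogonal hS hsym ha t hmax hxU
    (by simpa using hx0)))

/-- The compression `P S P` has at most as many eigenvalues of modulus at least `a > 0` as `S`,
counted with multiplicity. Its eigenvectors for nonzero eigenvalues lie in the range `V` of `P`, and
on their span `‖S x‖ ≥ ‖P S P x‖ ≥ a ‖x‖`. -/
lemma exists_finset_sum_finrank_compression_le [CompleteSpace E] {S S' : E →L[ℝ] E}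
    (hS : IsCompactOperator S) (hsym : S.IsSymmetric) (hS' : IsCompactOperator S')
    (hsym' : S'.IsSymmetric) (V : Submodule ℝ E) [V.HasOrthogonalProjection]
    (hcomp : ∀ x, S' x = V.starProjection (S (V.starProjection x))) {a : ℝ} (ha : 0 < a)
    (s : Finset ℝ) (hs : ∀ μ ∈ s, a ≤ |μ|) :
    ∃ t : Finset ℝ, (∀ μ ∈ t, a ≤ |μ|) ∧
      ∑ μ ∈ s, finrank ℝ (eigenspace (S' : E →ₗ[ℝ] E) μ) ≤
        ∑ μ ∈ t, finrank ℝ (eigenspace (S : E →ₗ[ℝ] E) μ) := by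
  obtain ⟨hfin, hdim⟩ := finrank_biSup_of_iSupIndep
    (eigenspaces_iSupIndep (S' : E →ₗ[ℝ] E)) s fun μ hμ =>
      ContinuousLinearMap.finite_dimensional_eigenspace hS' μ (abs_pos.1 (ha.trans_le (hs μ hμ)))
  have hV : ⨆ μ ∈ s, eigenspace (S' : E →ₗ[ℝ] E) μ ≤ V := by
    refine iSup₂_le fun μ hμ x hx => ?_
    have hμ0 : μ ≠ 0 := abs_pos.1 (ha.trans_le (hs μ hμ))
    have h1 : S' x = μ • x := mem_eigenspace_iff.1 hx
    rw [← inv_smul_smul₀ hμ0 x, ← h1, hcomp]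
    exact V.smul_mem _ (V.starProjection_apply_mem _)
  rw [← hdim]
  refine exists_finset_finrank_le_sum hS hsym ha _ fun x hx => ?_
  refine (le_norm_apply_of_mem_biSup_eigenspace hsym' ha.le s hs hx).trans ?_
  have h2 : V.starProjection x = x := V.starProjection_eq_self_iff.2 (hV hx)
  change ‖S' x‖ ≤ _
  rw [hcomp, h2]
  exact V.norm_starProjection_apply_le _

end Spectral

/-! ### Comparison of spectral penalties -/

/-- If for every threshold `a > 0` the weights `w` put at least as much mass on `{|μ| ≥ a}` as `w'`,
then the same comparison holds for the weighted sums of `ψ |μ|`. By the layer-cake formula it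
suffices to compare the masses of the sets `{x < ψ |μ|}` with `x > 0`; these are upward closed in
`|μ|` and avoid `0`. -/
lemma sum_mul_le_sum_mul_of_count_le {ψ : ℝ → ℝ} (hψ : MonotoneOn ψ (Set.Ici 0)) (hψ0 : ψ 0 = 0)
    (w w' : ℝ → ℕ)
    (h : ∀ a : ℝ, 0 < a → ∀ s : Finset ℝ, (∀ μ ∈ s, a ≤ |μ|) →
      ∃ t : Finset ℝ, (∀ μ ∈ t, a ≤ |μ|) ∧ ∑ μ ∈ s, w' μ ≤ ∑ μ ∈ t, w μ) :
    ∑' μ, (w' μ : ℝ≥0∞) * ENNReal.ofReal (ψ |μ|) ≤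
      ∑' μ, (w μ : ℝ≥0∞) * ENNReal.ofReal (ψ |μ|) := by
  classical
  have hcake : ∀ (v : ℝ → ℕ) (r : Finset ℝ), ∑ μ ∈ r, (v μ : ℝ≥0∞) * ENNReal.ofReal (ψ |μ|) =
      ∫⁻ x : ℝ in Set.Ioi 0, ((∑ μ ∈ r with x < ψ |μ|, v μ : ℕ) : ℝ≥0∞) := by
    intro v r
    have h1 : ∀ x : ℝ, ((∑ μ ∈ r with x < ψ |μ|, v μ : ℕ) : ℝ≥0∞) =
        ∑ μ ∈ r, (v μ : ℝ≥0∞) * (Set.Iio (ψ |μ|)).indicator 1 x := by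
      intro x
      rw [Finset.sum_filter, Nat.cast_sum]
      refine Finset.sum_congr rfl fun μ _ => ?_
      by_cases hx : x < ψ |μ| <;> simp [hx]
    simp_rw [h1]
    rw [MeasureTheory.lintegral_finsetSum _ fun μ _ =>
      (measurable_one.indicator measurableSet_Iio).const_mul _]
    refine Finset.sum_congr rfl fun μ _ => ?_
    rw [MeasureTheory.lintegral_const_mul _ (measurable_one.indicator measurableSet_Iio),
      MeasureTheory.lintegral_indicator_one measurableSet_Iio,
      MeasureTheory.Measure.restrict_apply measurableSet_Iio, Set.Iio_inter_Ioi, Real.volume_Ioo,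
      sub_zero]
  rw [ENNReal.tsum_eq_iSup_sum]
  refine iSup_le fun s => ?_
  choose! τ hτ hτ' using h
  -- For finite `s` only the thresholds `|ν|` with `ν ∈ s` matter, so that finitely many terms of the
  -- sum over `w` suffice; this keeps the integrals below over finite sums.
  let t : Finset ℝ := s.biUnion fun ν =>
    τ |ν| (s.filter fun μ => |ν| ≤ |μ|)
  refine le_trans ?_ (ENNReal.sum_le_tsum t)
  rw [hcake, hcake]
  refine MeasureTheory.setLIntegral_mono' measurableSet_Ioi fun x hx => ?_
  have hx : 0 < x := hx
  rw [Nat.cast_le]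
  rcases (s.filter fun μ => x < ψ |μ|).eq_empty_or_nonempty with he | hne
  · rw [he]; simp
  -- `|ν|` is the effective threshold: the smallest modulus in the superlevel set.
  obtain ⟨ν, hν, hmin⟩ := Finset.exists_min_image _ (fun μ : ℝ => |μ|) hne
  rw [Finset.mem_filter] at hν
  have hν0 : 0 < |ν| := by
    refine (abs_nonneg ν).lt_of_ne fun h0 => ?_
    rw [← h0, hψ0] at hν
    exact lt_asymm hx hν.2
  have hs : ∀ μ ∈ s.filter (fun μ => |ν| ≤ |μ|), |ν| ≤ |μ| := fun μ hμ => (Finset.mem_filter.1 hμ).2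
  calc ∑ μ ∈ s with x < ψ |μ|, w' μ ≤ ∑ μ ∈ s with |ν| ≤ |μ|, w' μ := by
        refine Finset.sum_le_sum_of_subset fun μ hμ => ?_
        exact Finset.mem_filter.2 ⟨(Finset.mem_filter.1 hμ).1, hmin μ hμ⟩
    _ ≤ ∑ μ ∈ τ |ν| (s.filter fun μ => |ν| ≤ |μ|), w μ := hτ' _ hν0 _ hs
    _ ≤ ∑ μ ∈ t with x < ψ |μ|, w μ := by
        refine Finset.sum_le_sum_of_subset fun μ hμ => Finset.mem_filter.2 ⟨?_, ?_⟩
        · exact Finset.mem_biUnion.2 ⟨ν, hν.1, hμ⟩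
        · exact hν.2.trans_le (hψ (abs_nonneg ν) (abs_nonneg μ) (hτ _ hν0 _ hs μ hμ))

variable {𝒯 : Type*} {H : Type*} [NormedAddCommGroup H] [InnerProductSpace ℝ H]
  [CompleteSpace H] [RKHS ℝ H 𝒯 ℝ]

/-! ### The covariance operator of an element of the tensor product space -/

variable (H) in
lemma denseRange_linearCombination_kfun :
    DenseRange (Finsupp.linearCombination ℝ (kfun H) : (𝒯 →₀ ℝ) → H) := by
  have hle : Submodule.span ℝ {RKHS.kerFun H x r | (x : 𝒯) (r : ℝ)} ≤
      LinearMap.range (Finsupp.linearCombination ℝ (kfun H)) := by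
    rw [Submodule.span_le]
    rintro _ ⟨x, r, rfl⟩
    refine ⟨Finsupp.single x r, ?_⟩
    rw [Finsupp.linearCombination_single, kfun, ← map_smul, smul_eq_mul, mul_one]
  intro f
  have hf : f ∈ (Submodule.span ℝ {RKHS.kerFun H x r | (x : 𝒯) (r : ℝ)}).topologicalClosure := by
    rw [RKHS.kerFun_dense]; trivial
  exact closure_mono hle hf

/-- Boundedness of `𝒞_C`, by the closed graph theorem: evaluations are continuous, and
`f ↦ (𝒞_C f)(s)` is an inner product with a fixed vector. -/
lemma continuous_covOp (C : TensorRKHS H) : Continuous (covOp C) := by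
  refine LinearMap.continuous_of_seq_closed_graph _ fun u x y hu hy => RKHS.ext (𝕜 := ℝ) fun s => ?_
  have h1 := ((RKHS.continuous_eval (𝕜 := ℝ) s).tendsto y).comp hy
  have h2 : Filter.Tendsto (fun n => ⟪slice C s, u n⟫_ℝ) Filter.atTop (nhds ⟪slice C s, x⟫_ℝ) :=
    tendsto_const_nhds.inner hu
  rw [covOp_apply]
  refine tendsto_nhds_unique h1 (h2.congr fun n => ?_)
  exact (covOp_apply C (u n) s).symm

lemma inner_covOp_kfun (C : TensorRKHS H) (s t : 𝒯) :
    ⟪kfun H s, covOp C (kfun H t)⟫_ℝ = C (s, t) := by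
  rw [inner_kfun, covOp_apply, real_inner_comm, inner_kfun, slice_apply]

/-- The operator norm of `𝒞_C` is at most `‖C‖`, in bilinear form. On finite combinations of kernel
sections this is the Cauchy–Schwarz inequality of `H(K ⊗ K)`; the rest is density. -/
lemma inner_covOp_le (C : TensorRKHS H) (f g : H) :
    ⟪g, covOp C f⟫_ℝ ≤ ‖C‖ * (‖g‖ * ‖f‖) := by
  have hc := continuous_covOp C
  refine (denseRange_linearCombination_kfun H).induction_on₂
    (p := fun g f => ⟪g, covOp C f⟫_ℝ ≤ ‖C‖ * (‖g‖ * ‖f‖))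
    (isClosed_le (by fun_prop) (by fun_prop)) (fun a b => ?_) g f
  refine le_of_eq_of_le ?_ (bilin_bound C a b)
  simp only [Finsupp.linearCombination_apply, Finsupp.sum, map_sum, map_smul, sum_inner, inner_sum,
    real_inner_smul_left, real_inner_smul_right, inner_covOp_kfun]
  rw [Finset.sum_comm]
  exact Finset.sum_congr rfl fun s _ => Finset.sum_congr rfl fun t _ => by ring

variable (H) in
/-- The map `C ↦ 𝒞_C` as a linear contraction from `H(K ⊗ K)` into the bounded operators on
`H(K)`. -/
def covOpL : TensorRKHS H →L[ℝ] H →L[ℝ] H :=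
  LinearMap.mkContinuous
    { toFun := fun C => ⟨covOp C, continuous_covOp C⟩
      map_add' := fun C D => by
        ext f s
        have h : slice (C + D) s = slice C s + slice D s :=
          RKHS.ext (𝕜 := ℝ) fun t => by simp
        simp [covOp_apply, h, inner_add_left]
      map_smul' := fun c C => by
        ext f s
        have h : slice (c • C) s = c • slice C s := RKHS.ext (𝕜 := ℝ) fun t => by simp
        simp [covOp_apply, h, real_inner_smul_left] } 1 fun C => by
    rw [one_mul]
    refine ContinuousLinearMap.opNorm_le_bound _ (norm_nonneg _) fun f => ?_
    change ‖covOp C f‖ ≤ _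
    rcases eq_or_ne ‖covOp C f‖ 0 with h0 | h0
    · rw [h0]; positivity
    · have h := inner_covOp_le C f (covOp C f)
      rw [real_inner_self_eq_norm_mul_norm] at h
      refine le_of_mul_le_mul_right ?_ (lt_of_le_of_ne (norm_nonneg _) h0.symm)
      linarith

lemma inner_covOpL_kfun (C : TensorRKHS H) (s t : 𝒯) :
    ⟪kfun H s, covOpL H C (kfun H t)⟫_ℝ = C (s, t) :=
  inner_covOp_kfun C s t

lemma covOpL_kfun (p : 𝒯 × 𝒯) :
    covOpL H (kfun (TensorRKHS H) p) = InnerProductSpace.rankOne ℝ (kfun H p.1) (kfun H p.2) := by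
  ext f s
  have h : slice (kfun (TensorRKHS H) p) s = K H s p.1 • kfun H p.2 :=
    RKHS.ext (𝕜 := ℝ) fun t => by
      rw [slice_apply, RKHS.coe_smul]
      exact K_tensor H (s, t) p
  change covOp _ f s = _
  rw [covOp_apply, h, real_inner_smul_left, InnerProductSpace.rankOne_apply, RKHS.coe_smul,
    Pi.smul_apply, smul_eq_mul, mul_comm]
  rfl

lemma isCompactOperator_rankOne {E : Type*} [NormedAddCommGroup E] [InnerProductSpace ℝ E]
    (x y : E) : IsCompactOperator (InnerProductSpace.rankOne ℝ x y) :=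
  (isCompactOperator_of_locallyCompactSpace_rng (ContinuousLinearMap.toSpanSingleton ℝ x)).comp_clm
    (innerSL ℝ y)

/-- `𝒞_C` is compact: the kernel sections span a dense subspace of `H(K ⊗ K)`, they are sent to
rank-one operators, and `C ↦ 𝒞_C` is continuous for the operator norm. -/
lemma isCompactOperator_covOpL (C : TensorRKHS H) : IsCompactOperator (covOpL H C) := by
  refine (denseRange_linearCombination_kfun (TensorRKHS H)).induction_on
    (p := fun C => IsCompactOperator (covOpL H C)) C
    (isClosed_setOfPred_isCompactOperator.preimage (covOpL H).continuous) fun c => ?_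
  rw [Finsupp.linearCombination_apply, Finsupp.sum, map_sum]
  refine Submodule.sum_mem (compactOperator (RingHom.id ℝ) H H) fun p _ => ?_
  rw [map_smul, covOpL_kfun]
  exact Submodule.smul_mem _ _ (isCompactOperator_rankOne _ _)

lemma mem_symSet_iff_isSymmetric (C : TensorRKHS H) :
    C ∈ symSet H ↔ (covOpL H C).IsSymmetric := by
  constructor
  · intro hC f g
    change ⟪covOpL H C f, g⟫_ℝ = ⟪f, covOpL H C g⟫_ℝ
    refine (denseRange_linearCombination_kfun H).induction_on₂
      (p := fun f g => ⟪covOpL H C f, g⟫_ℝ = ⟪f, covOpL H C g⟫_ℝ)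
      (isClosed_eq (by fun_prop) (by fun_prop)) (fun a b => ?_) f g
    simp only [Finsupp.linearCombination_apply, Finsupp.sum, map_sum, map_smul, sum_inner,
      inner_sum, real_inner_smul_left, real_inner_smul_right]
    refine Finset.sum_congr rfl fun s _ => Finset.sum_congr rfl fun t _ => ?_
    rw [real_inner_comm, inner_covOpL_kfun, inner_covOpL_kfun, hC s t]
  · intro hC s t
    have h : ⟪covOpL H C (kfun H s), kfun H t⟫_ℝ = ⟪kfun H s, covOpL H C (kfun H t)⟫_ℝ :=
      hC (kfun H s) (kfun H t)
    rw [real_inner_comm, inner_covOpL_kfun, inner_covOpL_kfun] at h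
    exact h.symm

/-! ### Compression to the span of finitely many kernel sections -/

section Compression

variable {N : ℕ} (u : Fin N → 𝒯)

variable (H) in
/-- The span of the kernel sections `K(·, uᵢ)`, as a subspace of `H(K)`. -/
def sectionSpan : Submodule ℝ H := Submodule.span ℝ (Set.range fun i => kfun H (u i))

instance : FiniteDimensional ℝ (sectionSpan H u) :=
  FiniteDimensional.span_of_finite ℝ (Set.finite_range _)

variable (H) in
/-- The span of the kernel sections `(K ⊗ K)(·, (uᵢ, uⱼ))`, as a subspace of `H(K ⊗ K)`. -/
def tensorSectionSpan : Submodule ℝ (TensorRKHS H) :=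
  Submodule.span ℝ (Set.range fun ij : Fin N × Fin N => kfun (TensorRKHS H) (u ij.1, u ij.2))

lemma rankOne_mem_map_tensorSectionSpan {x y : H} (hx : x ∈ sectionSpan H u)
    (hy : y ∈ sectionSpan H u) :
    InnerProductSpace.rankOne ℝ x y ∈
      (tensorSectionSpan H u).map (covOpL H : TensorRKHS H →ₗ[ℝ] H →L[ℝ] H) := by
  induction hx, hy using Submodule.span_induction₂ with
  | mem_mem x y hx hy =>
    obtain ⟨i, rfl⟩ := hx
    obtain ⟨j, rfl⟩ := hy
    exact ⟨_, Submodule.subset_span ⟨(i, j), rfl⟩, covOpL_kfun _⟩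
  | zero_left y hy => simp
  | zero_right x hx => simp
  | add_left x y z _ _ _ h1 h2 =>
    rw [map_add]; exact add_mem h1 h2
  | add_right x y z _ _ _ h1 h2 => rw [map_add]; exact add_mem h1 h2
  | smul_left r x y _ _ h => rw [map_smul]; exact Submodule.smul_mem _ r h
  | smul_right r x y _ _ h => rw [map_smulₛₗ]; exact Submodule.smul_mem _ _ h

/-- The compression `P 𝒞_C P` to the span `V` of the sections `K(·, uᵢ)` is again of the form `𝒞_D`,
with `D` in the span of the sections of `K ⊗ K` at the pairs `(uᵢ, uⱼ)`: it is a finite sum of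
rank-one operators built from vectors of `V`. -/
lemma exists_covOpL_eq_compression (C : TensorRKHS H) :
    ∃ D ∈ tensorSectionSpan H u, ∀ f, covOpL H D f =
      (sectionSpan H u).starProjection (covOpL H C ((sectionSpan H u).starProjection f)) := by
  set V := sectionSpan H u
  let b := stdOrthonormalBasis ℝ V
  have hmem : ∑ i, InnerProductSpace.rankOne ℝ (V.starProjection (covOpL H C (b i))) (b i : H) ∈
      (tensorSectionSpan H u).map (covOpL H : TensorRKHS H →ₗ[ℝ] H →L[ℝ] H) :=
    Submodule.sum_mem _ fun i _ =>
      rankOne_mem_map_tensorSectionSpan u (V.starProjection_apply_mem _) (b i).2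
  obtain ⟨D, hD, hDC⟩ := hmem
  refine ⟨D, hD, fun f => ?_⟩
  have hDC : covOpL H D = _ := hDC
  have hproj : V.starProjection f = ∑ i, ⟪(b i : H), f⟫_ℝ • (b i : H) := by
    have h := congrArg (Subtype.val (p := (· ∈ V))) (b.sum_repr' (V.orthogonalProjectionOnto f))
    rw [Submodule.starProjection_apply, ← h]
    simp
  rw [hDC, hproj]
  simp [V]

lemma coe_mem_kernelSpan {D : TensorRKHS H} (hD : D ∈ tensorSectionSpan H u) :
    (⇑D : 𝒯 × 𝒯 → ℝ) ∈ kernelSpan H u := by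
  induction hD using Submodule.span_induction with
  | mem D hD =>
    obtain ⟨ij, rfl⟩ := hD
    refine Submodule.subset_span ⟨ij, ?_⟩
    funext p
    exact (K_tensor H p (u ij.1, u ij.2)).symm
  | zero => rw [RKHS.coe_zero (𝕜 := ℝ)]; exact zero_mem _
  | add D E _ _ h1 h2 => rw [RKHS.coe_add (𝕜 := ℝ)]; exact add_mem h1 h2
  | smul c D _ h => rw [RKHS.coe_smul]; exact Submodule.smul_mem _ c h

/-- Since the sections `K(·, uᵢ)` may be linearly dependent, the coefficient matrix of a symmetric
function is not unique and need not be symmetric; its symmetric part represents the same function. -/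
lemma exists_isSymm_matrix_of_mem_kernelSpan {c : 𝒯 × 𝒯 → ℝ} (hc : c ∈ kernelSpan H u)
    (hsymm : ∀ s t, c (s, t) = c (t, s)) :
    ∃ A : Matrix (Fin N) (Fin N) ℝ, A.IsSymm ∧
      ∀ s t, c (s, t) = z H u s ⬝ᵥ A.mulVec (z H u t) := by
  obtain ⟨B, hB⟩ : ∃ B : Matrix (Fin N) (Fin N) ℝ,
      ∀ s t, c (s, t) = z H u s ⬝ᵥ B.mulVec (z H u t) := by
    obtain ⟨a, rfl⟩ := (Submodule.mem_span_range_iff_exists_fun ℝ).1 hc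
    refine ⟨Matrix.of fun i j => a (i, j), fun s t => ?_⟩
    simp only [Finset.sum_apply, Pi.smul_apply, tensorFun, smul_eq_mul, Fintype.sum_prod_type,
      dotProduct, Matrix.mulVec, Matrix.of_apply, z, Finset.mul_sum]
    exact Finset.sum_congr rfl fun i _ => Finset.sum_congr rfl fun j _ => by ring
  refine ⟨(1 / 2 : ℝ) • (B + Bᵀ), ?_, fun s t => ?_⟩
  · rw [Matrix.IsSymm, Matrix.transpose_smul, Matrix.transpose_add, Matrix.transpose_transpose,
      add_comm]
  · have h1 : z H u s ⬝ᵥ Bᵀ.mulVec (z H u t) = c (s, t) := by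
      rw [Matrix.mulVec_transpose, dotProduct_comm, ← Matrix.dotProduct_mulVec, ← hB, hsymm]
    rw [Matrix.smul_mulVec, Matrix.add_mulVec, dotProduct_smul, dotProduct_add, h1, ← hB,
      smul_eq_mul]
    ring

end Compression

/-! ### The spectral penalty and the minimization problem -/

lemma Psi_le_of_compression {ψ : ℝ → ℝ} (hψ : MonotoneOn ψ (Set.Ici 0)) (hψ0 : ψ 0 = 0)
    {C D : TensorRKHS H} (hC : C ∈ symSet H) (hD : D ∈ symSet H) (V : Submodule ℝ H)
    [V.HasOrthogonalProjection]
    (hDC : ∀ f, covOpL H D f = V.starProjection (covOpL H C (V.starProjection f))) :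
    Psi ψ D ≤ Psi ψ C :=
  sum_mul_le_sum_mul_of_count_le hψ hψ0 _ _ fun _ ha s hs =>
    exists_finset_sum_finrank_compression_le (isCompactOperator_covOpL C)
      ((mem_symSet_iff_isSymmetric C).1 hC) (isCompactOperator_covOpL D)
      ((mem_symSet_iff_isSymmetric D).1 hD) V hDC ha s hs

end CovRKHS

end

theorem theorem1 {𝒯 : Type*} {H : Type*} [NormedAddCommGroup H] [InnerProductSpace ℝ H]
    [CompleteSpace H] [RKHS ℝ H 𝒯 ℝ]
    {n m : ℕ} (T : Fin n → Fin m → 𝒯)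
    (l : CovRKHS.TensorRKHS H → ℝ)
    (hl : ∀ C ∈ CovRKHS.symSet H, ∀ C' ∈ CovRKHS.symSet H,
      (∀ i j k, C (T i j, T i k) = C' (T i j, T i k)) → l C = l C')
    (lam : ℝ) (hlam : 0 < lam)
    (ψ : ℝ → ℝ) (hψ : MonotoneOn ψ (Set.Ici 0)) (hψ0 : ψ 0 = 0)
    (F : Set (CovRKHS.TensorRKHS H)) (hF : F = CovRKHS.posSet H ∨ F = CovRKHS.symSet H)
    (hsol : (CovRKHS.solutionSet F l lam ψ).Nonempty) :
    (∃ C ∈ CovRKHS.solutionSet F l lam ψ,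
      (⇑C : 𝒯 × 𝒯 → ℝ) ∈ CovRKHS.kernelSpan H (CovRKHS.pooled T)) ∧
    (∀ C ∈ CovRKHS.solutionSet F l lam ψ,
      (⇑C : 𝒯 × 𝒯 → ℝ) ∈ CovRKHS.kernelSpan H (CovRKHS.pooled T) →
      ∃ A : Matrix (Fin (n * m)) (Fin (n * m)) ℝ, A.IsSymm ∧
        ∀ s t, C (s, t) =
          CovRKHS.z H (CovRKHS.pooled T) s ⬝ᵥ
            (A.mulVec (CovRKHS.z H (CovRKHS.pooled T) t))) := by
  have hFsym : F ⊆ CovRKHS.symSet H := by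
    rcases hF with rfl | rfl
    · exact fun C hC => hC.1
    · exact subset_rfl
  refine ⟨?_, fun C hC hmem =>
    CovRKHS.exists_isSymm_matrix_of_mem_kernelSpan _ hmem (hFsym hC.1)⟩
  obtain ⟨C, hCF, hmin⟩ := hsol
  have hCs := hFsym hCF
  -- The minimizer in the span is the compression `D` of an arbitrary minimizer `C`.
  obtain ⟨D, hDspan, hDC⟩ := CovRKHS.exists_covOpL_eq_compression (CovRKHS.pooled T) C
  set V := CovRKHS.sectionSpan H (CovRKHS.pooled T)
  have hinner : ∀ f g : H, ⟪f, CovRKHS.covOpL H D g⟫_ℝ =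
      ⟪V.starProjection f, CovRKHS.covOpL H C (V.starProjection g)⟫_ℝ := fun f g => by
    rw [hDC, Submodule.inner_starProjection_left_eq_right]
  have hDs : D ∈ CovRKHS.symSet H := by
    refine (CovRKHS.mem_symSet_iff_isSymmetric D).2 fun f g => ?_
    have h : ⟪CovRKHS.covOpL H C (V.starProjection f), V.starProjection g⟫_ℝ =
        ⟪V.starProjection f, CovRKHS.covOpL H C (V.starProjection g)⟫_ℝ :=
      (CovRKHS.mem_symSet_iff_isSymmetric C).1 hCs _ _
    change ⟪CovRKHS.covOpL H D f, g⟫_ℝ = ⟪f, CovRKHS.covOpL H D g⟫_ℝ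
    rw [hinner, ← h, real_inner_comm, hinner, real_inner_comm]
  have hDF : D ∈ F := by
    rcases hF with rfl | rfl
    · refine ⟨hDs, fun f => ?_⟩
      have h : 0 ≤ ⟪CovRKHS.covOpL H C (V.starProjection f), V.starProjection f⟫_ℝ := hCF.2 _
      change 0 ≤ ⟪CovRKHS.covOpL H D f, f⟫_ℝ
      rwa [real_inner_comm, hinner, real_inner_comm]
    · exact hDs
  have hproj : ∀ i j, V.starProjection (CovRKHS.kfun H (T i j)) = CovRKHS.kfun H (T i j) :=
    fun i j => V.starProjection_eq_self_iff.2
      (Submodule.subset_span ⟨finProdFinEquiv (i, j), by simp [CovRKHS.pooled]⟩)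
  -- `D` and `C` agree at all pairs of sampling points, since the projection fixes the sections there.
  have hlD : l D = l C := hl D hDs C hCs fun i j k => by
    rw [← CovRKHS.inner_covOpL_kfun, ← CovRKHS.inner_covOpL_kfun, hinner, hproj, hproj]
  refine ⟨D, ⟨hDF, fun C' hC' => le_trans ?_ (hmin C' hC')⟩,
    CovRKHS.coe_mem_kernelSpan _ hDspan⟩
  rw [CovRKHS.objective, CovRKHS.objective, hlD]
  refine add_le_add le_rfl (EReal.coe_ennreal_le_coe_ennreal_iff.2 ?_)
  exact mul_le_mul_right (CovRKHS.Psi_le_of_compression hψ hψ0 hCs hDs V hDC) _
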